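/- Let $S$ be a surface. An oriented diagram on $S$ of a knot in $S\times S^1$ is an oriented closed curve on $S$ with finitely many multiple points, all transverse double points (crossings), each of them either classical (with over/under information) or virtual, together with finitely many vertices (double lines) away from the crossings; a vertex records which of its two ends is the longer line (the end of an arc near $S\times\{1\}$) and which is the shorter line (the end of an arc near $S\times\{0\}$). The degree of $D$ is the signed number of vertices, a vertex counting $+1$ if its longer line is met first when walking along the orientation and $-1$ otherwise. Two diagrams in $S\times S^1$ are equivalent if they are related by a finite sequence of isotopies (with orientation preserving reparametrization) and the following local moves and their inverses: the classical Reidemeister moves (1), (2), (3), the virtual moves (1'), (2'), (3') and the mixed move (3'') (an arc with two virtual crossings passes a classical crossing), all in discs containing no vertex; (4), (4'): a vertex and an arc crossing the knot next to it pass each other, where in the classical case (4) the arc is under the piece at the longer line and over the piece at the shorter line, so that the over/under information is switched, and in (4') the crossing is virtual before and after; (5): creation or removal of two consecutive vertices of opposite sign with no crossing between them. Let $D$ have degree $0$ and fix a point on $D$ that is not a vertex. Starting with label $0$ at the fixed point, walk along $D$ and raise (lower) the label by $1$ at each vertex whose longer (shorter) line is met first. The lifted diagram $\hat D$ is obtained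 by placing the points with label $k$ on the $k$-th of a stack of parallel horizontal planes, connecting the two ends at every vertex vertically, and looking from above: $\hat D$ is the same curve without vertices; at a classical crossing of $D$ whose branches have different labels the branch with the larger label is over, at a classical crossing whose branches have equal labels the over/under information is that of $D$, and virtual crossings remain virtual. **Theorem.** Let $D$ and $D'$ be oriented knot diagrams in $S\times S^1$, with $D$ of degree $0$, and suppose that $D$ and $D'$ are equivalent. Then $D'$ has degree $0$, and for all choices of the fixed points $\hat D$ and $\hat D'$ are equivalent as knots in $S\times\mathbb R$. Precisely: 1. If $S$ is the plane and diagrams may have virtual crossings, then $\hat D$ and $\hat D'$ are equivalent as virtual knot diagrams, i.e. under isotopy and the moves (1), (2), (3), (1'), (2'), (3'), (3''). 2. If $S$ is any surface without boundary (such as a closed surface $S_g$) and $D$, $D'$ are equivalent through diagrams without virtual crossings, then $\hat D$ and $\hat D'$ are equivalent under isotopy on $S$ and the moves (1), (2), (3), through diagrams without virtual crossings. -/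

import Mathlib

open Set Topology

noncomputable section

/-- The parameter circle `ℝ/ℤ` of an oriented knot diagram, with its cyclic order:
`Set.cIcc a b` (`Set.cIoo a b`) is the closed (open) arc travelled from `a` to `b`. -/
abbrev Circ : Type := UnitAddCircle

/-- The Euclidean plane. -/
abbrev Plane : Type := EuclideanSpace ℝ (Fin 2)

/-- The closed unit disc. -/
abbrev UnitDisc : Type := Metric.closedBall (0 : Plane) 1

/-- An oriented knot diagram on a surface `S`, possibly with virtual crossings: a closed curve
with finitely many multiple points, all of them transverse double points, each of which is
classical (one of its two branches is the over-branch) or virtual (neither branch is over).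
On the plane this is a virtual knot diagram; on `S` without virtual crossings it is a diagram
of a knot in `S × ℝ`. -/
structure KnotDiagram (S : Type*) [TopologicalSpace S] where
  /-- The oriented closed curve. -/
  curve : Circ → S
  continuous_curve : Continuous curve
  /-- `isOver s t`: the parameters `s`, `t` are those of a classical crossing, and the branch at `s`
  passes over the branch at `t`. -/
  isOver : Circ → Circ → Prop
  finite_double : {t | ∃ s, s ≠ t ∧ curve s = curve t}.Finite
  no_triple : ∀ r s t, curve r = curve s → curve s = curve t → r = s ∨ s = t ∨ r = t
  /-- Around a double point there is a chart in which the two branches lie on the two axes. -/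
  transverse : ∀ s t, s ≠ t → curve s = curve t →
    ∃ e : OpenPartialHomeomorph S (ℝ × ℝ), curve s ∈ e.source ∧ e (curve s) = 0 ∧
      (∀ᶠ u in 𝓝 s, (e (curve u)).2 = 0) ∧ (∀ᶠ u in 𝓝 t, (e (curve u)).1 = 0)
  over_double : ∀ s t, isOver s t → s ≠ t ∧ curve s = curve t
  over_asymm : ∀ s t, isOver s t → ¬ isOver t s

namespace KnotDiagram

variable {S : Type*} [TopologicalSpace S]

/-- `t` is a parameter of a crossing (classical or virtual). -/
def IsDouble (D : KnotDiagram S) (t : Circ) : Prop := ∃ s, s ≠ t ∧ D.curve s = D.curve t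

/-- `s` and `t` are the two parameters of a crossing. -/
def Crossing (D : KnotDiagram S) (s t : Circ) : Prop := s ≠ t ∧ D.curve s = D.curve t

/-- `s` and `t` are the two parameters of a classical crossing. -/
def Classical (D : KnotDiagram S) (s t : Circ) : Prop := D.isOver s t ∨ D.isOver t s

/-- All crossings are classical. -/
def NoVirtual (D : KnotDiagram S) : Prop := ∀ s t, D.Crossing s t → D.Classical s t

/-- Orientation preserving homeomorphisms of the parameter circle. -/
def OrientationPreserving (ρ : Circ ≃ₜ Circ) : Prop :=
  ∀ a b c, sbtw a b c → sbtw (ρ a) (ρ b) (ρ c)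

/-- An ambient isotopy of `S`, starting at the identity. -/
structure IsAmbientIsotopy (F : unitInterval → S ≃ₜ S) : Prop where
  continuous : Continuous fun x : unitInterval × S => F x.1 x.2
  zero : F 0 = Homeomorph.refl S

/-- `D'` is the result of moving `D` by the ambient isotopy `F` and reparametrising by `ρ`. -/
structure IsotopicVia (D D' : KnotDiagram S) (F : unitInterval → S ≃ₜ S) (ρ : Circ ≃ₜ Circ) :
    Prop where
  isotopy : IsAmbientIsotopy F
  orientation : OrientationPreserving ρ
  curve_eq : ∀ t, D'.curve t = F 1 (D.curve (ρ t))
  over_iff : ∀ s t, D'.isOver s t ↔ D.isOver (ρ s) (ρ t)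

/-- The part of `D` inside the embedded disc `f` consists of the `n` arcs of `D` with parameters in
`[a i, b i]`. They run from boundary to boundary through the interior of the disc; no crossing
lies on the boundary of the disc. -/
structure MeetsDisc (D : KnotDiagram S) (f : UnitDisc → S) {n : ℕ} (a b : Fin n → Circ) :
    Prop where
  embedding : IsEmbedding f
  ne : ∀ i, a i ≠ b i
  disjoint : ∀ i j, i ≠ j → Disjoint (cIcc (a i) (b i)) (cIcc (a j) (b j))
  mem_iff : ∀ t, D.curve t ∈ range f ↔ ∃ i, t ∈ cIcc (a i) (b i)
  boundary : ∀ i, D.curve (a i) ∈ f '' {z | ‖(z : Plane)‖ = 1} ∧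
    D.curve (b i) ∈ f '' {z | ‖(z : Plane)‖ = 1}
  interior : ∀ i, ∀ t ∈ cIoo (a i) (b i), D.curve t ∈ f '' {z | ‖(z : Plane)‖ < 1}
  simple_ends : ∀ i, ¬ D.IsDouble (a i) ∧ ¬ D.IsDouble (b i)

/-- `D` and `D'` both meet the disc `f` in arcs with parameters in `[a i, b i]`, and they coincide
outside the interior of that disc. -/
structure SameOutside (D D' : KnotDiagram S) (f : UnitDisc → S) {n : ℕ} (a b : Fin n → Circ) :
    Prop where
  left : D.MeetsDisc f a b
  right : D'.MeetsDisc f a b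
  curve_eq : ∀ t, (∀ i, t ∉ cIoo (a i) (b i)) → D.curve t = D'.curve t
  over_iff : ∀ s t, (∀ i, s ∉ cIoo (a i) (b i)) → (∀ i, t ∉ cIoo (a i) (b i)) →
    (D.isOver s t ↔ D'.isOver s t)

/-- First Reidemeister move, classical (1) or virtual (1'): an arc with exactly one crossing
inside a disc (a kink, of any crossing type) is replaced by an arc without crossings. -/
structure R1 (D D' : KnotDiagram S) (f : UnitDisc → S) (a b : Fin 1 → Circ) : Prop where
  same : SameOutside D D' f a b
  kink : ∃ s ∈ cIcc (a 0) (b 0), ∃ t ∈ cIcc (a 0) (b 0), D.Crossing s t ∧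
    ∀ s' ∈ cIcc (a 0) (b 0), D.IsDouble s' → s' = s ∨ s' = t
  straight : ∀ s ∈ cIcc (a 0) (b 0), ¬ D'.IsDouble s

/-- Second Reidemeister move, classical (2) or virtual (2'): two arcs inside a disc with exactly two
crossings, both of them between the two arcs, are replaced by two arcs without crossings. The
crossings are both virtual, or both classical with the same arc on top. -/
structure R2 (D D' : KnotDiagram S) (f : UnitDisc → S) (a b : Fin 2 → Circ) : Prop where
  same : SameOutside D D' f a b
  bigon : ∃ s₁ ∈ cIcc (a 0) (b 0), ∃ s₂ ∈ cIcc (a 0) (b 0),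
    ∃ t₁ ∈ cIcc (a 1) (b 1), ∃ t₂ ∈ cIcc (a 1) (b 1), s₁ ≠ s₂ ∧
      D.Crossing s₁ t₁ ∧ D.Crossing s₂ t₂ ∧
      (∀ i, ∀ r ∈ cIcc (a i) (b i), D.IsDouble r → r = s₁ ∨ r = s₂ ∨ r = t₁ ∨ r = t₂) ∧
      (D.isOver s₁ t₁ ↔ D.isOver s₂ t₂) ∧ (D.isOver t₁ s₁ ↔ D.isOver t₂ s₂)
  straight : ∀ i, ∀ r ∈ cIcc (a i) (b i), ¬ D'.IsDouble r

/-- The arc `[a i, b i]` passes over the arc `[a j, b j]` at some classical crossing. -/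
def ArcOver (D : KnotDiagram S) {n : ℕ} (a b : Fin n → Circ) (i j : Fin n) : Prop :=
  ∃ s ∈ cIcc (a i) (b i), ∃ t ∈ cIcc (a j) (b j), D.isOver s t

/-- Each of the arcs is simple, and any two of them cross exactly once. -/
def PairwiseCrossOnce (D : KnotDiagram S) {n : ℕ} (a b : Fin n → Circ) : Prop :=
  (∀ i, InjOn D.curve (cIcc (a i) (b i))) ∧
  ∀ i j, i ≠ j → ∃! x : Circ × Circ,
    x.1 ∈ cIcc (a i) (b i) ∧ x.2 ∈ cIcc (a j) (b j) ∧ D.Crossing x.1 x.2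

/-- Third Reidemeister move, classical (3), virtual (3') or mixed (3''): three arcs inside a
disc, any two crossing exactly once, are replaced by three such arcs with the same ends. The crossing
of each pair has the same type before and after. Either all three crossings are
classical and the three arcs are stacked (one on top, one in the middle, one at the bottom), or one
of the arcs crosses the two others virtually. -/
structure R3 (D D' : KnotDiagram S) (f : UnitDisc → S) (a b : Fin 3 → Circ) : Prop where
  same : SameOutside D D' f a b
  left : D.PairwiseCrossOnce a b
  right : D'.PairwiseCrossOnce a b
  over_iff : ∀ i j, D.ArcOver a b i j ↔ D'.ArcOver a b i j
  type : (∃ h : Fin 3 → ℤ, Function.Injective h ∧ ∀ i j, h j < h i → D.ArcOver a b i j) ∨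
    ∃ k, ∀ j, ¬ D.ArcOver a b k j ∧ ¬ D.ArcOver a b j k

/-- One generalized Reidemeister move, or an isotopy. -/
def Move (D D' : KnotDiagram S) : Prop :=
  (∃ F ρ, D.IsotopicVia D' F ρ) ∨ (∃ f a b, R1 D D' f a b) ∨ (∃ f a b, R2 D D' f a b) ∨
    ∃ f a b, R3 D D' f a b

/-- Equivalence under isotopy and the generalized Reidemeister moves (1), (2), (3), (1'), (2'), (3'),
(3''). For diagrams on the plane: equivalence of virtual knots. -/
def Equivalent : KnotDiagram S → KnotDiagram S → Prop := Relation.EqvGen Move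

/-- Equivalence under isotopy and the Reidemeister moves (1), (2), (3), all diagrams being
without virtual crossings: equivalence of knots in `S × ℝ`. -/
def ClassicallyEquivalent : KnotDiagram S → KnotDiagram S → Prop :=
  Relation.EqvGen fun D D' => Move D D' ∧ D.NoVirtual ∧ D'.NoVirtual

end KnotDiagram

/-- An oriented diagram of a knot in `S × S¹`: a knot diagram on `S` (possibly with virtual
crossings) together with finitely many vertices (double lines) away from the crossings. `mark t = 0`
means that there is no vertex at `t`; `mark t = 1` that there is one and that its longer line is met
first when walking along the orientation; `mark t = -1` that its shorter line is met first. The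
longer line belongs to the end of an arc near `S × {1}`, the shorter one to an end near
`S × {0}`. -/
structure CircleKnotDiagram (S : Type*) [TopologicalSpace S] extends KnotDiagram S where
  /-- The double lines. -/
  mark : Circ → SignType
  finite_mark : {t | mark t ≠ 0}.Finite
  mark_simple : ∀ t, mark t ≠ 0 → ¬ toKnotDiagram.IsDouble t

namespace CircleKnotDiagram

variable {S : Type*} [TopologicalSpace S]

/-- The degree: the signed number of double lines, that is, the number of times that the knot turns
around `S¹`. -/
def degree (D : CircleKnotDiagram S) : ℤ :=
  ∑ v ∈ D.finite_mark.toFinset, (D.mark v : ℤ)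

open Classical in
/-- The label at `t`, starting with label `0` at the fixed point `p`: walking from `p` to `t` along
the orientation, the label goes up by one at each double line whose longer line is met first and down
by one at each double line whose shorter line is met first. -/
def label (D : CircleKnotDiagram S) (p t : Circ) : ℤ :=
  ∑ v ∈ D.finite_mark.toFinset with sbtw p v t, (D.mark v : ℤ)

/-- The lifted diagram: every point `t` of the diagram is placed on the horizontal plane number
`label p t`, the ends at each double line are connected vertically, and the result is looked
at from above. So at a classical crossing of branches on different planes the one on the higher plane
is over; at a classical crossing inside one plane nothing changes; virtual crossings stay
virtual. -/
def lift (D : CircleKnotDiagram S) (p : Circ) : KnotDiagram S where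
  curve := D.curve
  continuous_curve := D.continuous_curve
  isOver s t := D.Classical s t ∧
    (D.label p t < D.label p s ∨ (D.label p s = D.label p t ∧ D.isOver s t))
  finite_double := D.finite_double
  no_triple := D.no_triple
  transverse := D.transverse
  over_double := by
    rintro s t ⟨h | h, -⟩
    · exact D.over_double s t h
    · exact ⟨(D.over_double t s h).1.symm, (D.over_double t s h).2.symm⟩
  over_asymm := by
    rintro s t ⟨-, h⟩ ⟨-, h'⟩
    rcases h with h | ⟨h, ho⟩ <;> rcases h' with h' | ⟨h', ho'⟩
    · omega
    · omega
    · omega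
    · exact D.over_asymm s t ho ho'

/-- `D` and `D'` have the same double lines, and none of them lies on the arcs `[a i, b i]`. -/
def SameMarksOff (D D' : CircleKnotDiagram S) {n : ℕ} (a b : Fin n → Circ) : Prop :=
  (∀ t, D.mark t = D'.mark t) ∧ ∀ i, ∀ t ∈ cIcc (a i) (b i), D.mark t = 0

/-- Moves (4) and (4'): a double line and an arc crossing the knot next to it pass each other. Here
the curve is fixed and the double line slides along it from `v` to `v'`, past a single crossing, with
parameters `s` (on the arc that carries the double line) and `u` (on the other arc). If the
crossing is virtual, it stays virtual. If it is classical, then the other arc is under the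
piece at the longer line and over the piece at the shorter line, so the crossing is switched. -/
structure SlideVia (D D' : CircleKnotDiagram S) (v v' s u : Circ) : Prop where
  curve_eq : ∀ t, D.curve t = D'.curve t
  between : sbtw v s v'
  crossing : D.Crossing s u
  only : ∀ t ∈ cIcc v v', t ≠ s → ¬ D.IsDouble t
  mark_ne : D.mark v ≠ 0
  mark_eq : D'.mark v' = D.mark v
  mark_left : ∀ t ∈ cIcc v v', t ≠ v → D.mark t = 0
  mark_right : ∀ t ∈ cIcc v v', t ≠ v' → D'.mark t = 0
  mark_off : ∀ t, t ∉ cIcc v v' → D.mark t = D'.mark t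
  over_iff : ∀ r t, ¬ (r = s ∧ t = u) → ¬ (r = u ∧ t = s) → (D.isOver r t ↔ D'.isOver r t)
  type : (¬ D.Classical s u ∧ ¬ D'.Classical s u) ∨
    (D.mark v = 1 ∧ D.isOver u s ∧ D'.isOver s u) ∨
    (D.mark v = -1 ∧ D.isOver s u ∧ D'.isOver u s)

/-- Move (5): two consecutive opposite double lines, at `v` and `v'`, without any crossing in
between, are removed. -/
structure CancelVia (D D' : CircleKnotDiagram S) (v v' : Circ) : Prop where
  curve_eq : ∀ t, D.curve t = D'.curve t
  over_iff : ∀ s t, D.isOver s t ↔ D'.isOver s t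
  ne : v ≠ v'
  no_double : ∀ t ∈ cIcc v v', ¬ D.IsDouble t
  mark_ne : D.mark v ≠ 0
  mark_neg : D.mark v' = -D.mark v
  mark_left : ∀ t ∈ cIcc v v', t ≠ v → t ≠ v' → D.mark t = 0
  mark_right : ∀ t ∈ cIcc v v', D'.mark t = 0
  mark_off : ∀ t, t ∉ cIcc v v' → D.mark t = D'.mark t

/-- One move for diagrams of knots in `S × S¹`: an isotopy, or one of (1), (1'), (2), (2'), (3),
(3'), (3'') away from the double lines, or one of (4), (4'), (5). -/
def Move (D D' : CircleKnotDiagram S) : Prop :=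
  (∃ F ρ, D.toKnotDiagram.IsotopicVia D'.toKnotDiagram F ρ ∧ ∀ t, D'.mark t = D.mark (ρ t)) ∨
  (∃ f a b, KnotDiagram.R1 D.toKnotDiagram D'.toKnotDiagram f a b ∧ SameMarksOff D D' a b) ∨
  (∃ f a b, KnotDiagram.R2 D.toKnotDiagram D'.toKnotDiagram f a b ∧ SameMarksOff D D' a b) ∨
  (∃ f a b, KnotDiagram.R3 D.toKnotDiagram D'.toKnotDiagram f a b ∧ SameMarksOff D D' a b) ∨
  (∃ v v' s u, SlideVia D D' v v' s u) ∨
  (∃ v v', CancelVia D D' v v')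

/-- Equivalence of diagrams with virtual crossings of knots in `S × S¹`. -/
def Equivalent : CircleKnotDiagram S → CircleKnotDiagram S → Prop := Relation.EqvGen Move

/-- Equivalence of diagrams on `S` without virtual crossings of knots in `S × S¹`, through diagrams
without virtual crossings. -/
def ClassicallyEquivalent : CircleKnotDiagram S → CircleKnotDiagram S → Prop :=
  Relation.EqvGen fun D D' => Move D D' ∧ D.NoVirtual ∧ D'.NoVirtual

end CircleKnotDiagram

end

/-!
Walking once around a diagram of degree `0` brings the label back to its initial value. So labels are
additive, `label p t = label p s + label s t` (`label_eq_label_add_label`), and moving the fixed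
point shifts all labels by one constant. Since the lifted diagram only compares the labels of the two
branches at a crossing, it does not depend on the fixed point at all (`lift_eq_lift`).

It remains to lift a single move (`Move.lift`).

* An isotopy preserves the cyclic order, hence carries labels to labels.
* The Reidemeister moves take place in a disc without vertices. The label is constant on each of the
  arcs in the disc (`label_eq_of_mem_cIcc`), so the arcs are placed on horizontal planes. The two
  crossings of a second Reidemeister move are lifted in the same way. In the third move the stacking
  order of the lifted arcs is the lexicographic one: first by label, then by the order in which the
  arcs are stacked in the diagram (`exists_lex_height`).
* Moves of vertices do not change the lifted diagram. Sliding a vertex and cancelling two opposite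
  vertices both alter the marks by a dipole (`AddsDipole`), which affects only the labels on the arc
  between its two vertices. For a cancellation there is no crossing on this arc. For a slide there is
  one, between the parameters `s` and `u`. There the label of `s` changes by the sign of the vertex,
  which is exactly offset by the switch of the over/under information: with sign `1`, the branch at
  `s` is over if and only if `label u ≤ label s`, where labels are taken after the slide.

A crossing is never a vertex, so its parameters are admissible fixed points; counting labels from
there makes both vertex moves a computation near one crossing.
-/

/-! ### Circular orders -/

section CircularOrder

variable {α : Type*} [CircularOrder α]

theorem sbtw_or_sbtw_of_ne {a b c : α} (hab : a ≠ b) (hbc : b ≠ c) (hca : c ≠ a) :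
    sbtw a b c ∨ sbtw c b a := by
  by_contra! h
  rcases btw_antisymm (btw_iff_not_sbtw.2 h.2) (btw_iff_not_sbtw.2 h.1) with h | h | h
  exacts [hab h, hbc h, hca h]

/-- A point `b` of the open arc from `a` to `c` cuts this arc into two. -/
theorem sbtw_iff_of_sbtw {a b c : α} (h : sbtw a b c) (v : α) :
    sbtw a v c ↔ sbtw a v b ∨ v = b ∨ sbtw b v c := by
  constructor
  · intro hv
    by_contra! hn
    obtain ⟨h1, h2, h3⟩ := hn
    have hav : a ≠ v := by rintro rfl; exact sbtw_irrefl_left hv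
    have hab : a ≠ b := by rintro rfl; exact sbtw_irrefl_left h
    have hvc : v ≠ c := by rintro rfl; exact sbtw_irrefl_right hv
    have hbc : b ≠ c := by rintro rfl; exact sbtw_irrefl_right h
    have h4 := (sbtw_or_sbtw_of_ne hav h2 hab.symm).resolve_left h1
    have h5 := (sbtw_or_sbtw_of_ne h2.symm hvc hbc.symm).resolve_left h3
    exact h4.not_sbtw (h5.cyclic_right.trans_left hv.cyclic_right).cyclic_right.cyclic_right
  · rintro (hv | rfl | hv)
    · exact hv.trans_right h
    · exact h
    · exact h.trans_left hv

/-- The two subarcs into which a point cuts an open arc are disjoint. -/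
theorem not_sbtw_of_sbtw_of_sbtw {a b c v : α} (h : sbtw a b c) (hv : sbtw a v b) :
    ¬ sbtw b v c := fun h' =>
  h'.cyclic_right.not_sbtw (h.cyclic_right.trans_left hv).cyclic_left

/-- Seen from a point `p` off the closed arc from `v` to `v'`, a point `t` off this arc lies beyond
`v` if and only if it lies beyond `v'`. -/
theorem sbtw_left_iff_right {p t v v' : α} (hp : sbtw v' p v) (ht : sbtw v' t v) :
    sbtw p v t ↔ sbtw p v' t := by
  constructor
  · exact fun h => h.trans_left ht.cyclic_right
  · intro h
    have hpt : p ≠ t := by rintro rfl; exact sbtw_irrefl_left_right h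
    have hpv : p ≠ v := by rintro rfl; exact sbtw_irrefl_right hp
    have htv : t ≠ v := by rintro rfl; exact sbtw_irrefl_right ht
    refine (sbtw_or_sbtw_of_ne hpv htv.symm hpt.symm).resolve_right fun h1 => ?_
    -- now `v', t, p` and `t, v, p` are in cyclic order, so `v` lies between `v'` and `p`
    exact (h.cyclic_left.trans_left h1).not_sbtw hp.cyclic_left

end CircularOrder

instance : Infinite Circ :=
  haveI : Infinite (Ico (0 : ℝ) (0 + 1)) := (Ico_infinite (by norm_num)).to_subtype
  (AddCircle.equivIco (1 : ℝ) 0).infinite_iff.2 inferInstance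

/-- An orientation preserving homeomorphism also reflects the cyclic order. -/
theorem KnotDiagram.OrientationPreserving.sbtw_iff {ρ : Circ ≃ₜ Circ}
    (h : KnotDiagram.OrientationPreserving ρ) (a b c : Circ) :
    sbtw (ρ a) (ρ b) (ρ c) ↔ sbtw a b c := by
  refine ⟨fun hs => ?_, h a b c⟩
  have hab : a ≠ b := by rintro rfl; exact sbtw_irrefl_left hs
  have hbc : b ≠ c := by rintro rfl; exact sbtw_irrefl_right hs
  have hca : c ≠ a := by rintro rfl; exact sbtw_irrefl_left_right hs
  exact (sbtw_or_sbtw_of_ne hab hbc hca).resolve_right fun h' => hs.not_sbtw (h _ _ _ h')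

/-! ### Labels and the degree -/

namespace CircleKnotDiagram

variable {S : Type*} [TopologicalSpace S]

theorem exists_mark_eq_zero (D : CircleKnotDiagram S) : ∃ p, D.mark p = 0 := by
  simpa using D.finite_mark.exists_notMem

/-- A crossing carries no vertex. -/
theorem mark_eq_zero_of_crossing (D : CircleKnotDiagram S) {s t : Circ} (h : D.Crossing s t) :
    D.mark s = 0 :=
  by_contra fun hs => D.mark_simple s hs ⟨t, h.1.symm, h.2.symm⟩

theorem crossing_of_classical (D : CircleKnotDiagram S) {s t : Circ} (h : D.Classical s t) :
    D.Crossing s t :=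
  h.elim (D.over_double s t) fun h => ⟨(D.over_double t s h).1.symm, (D.over_double t s h).2.symm⟩

theorem degree_eq_sum (D : CircleKnotDiagram S) {T : Finset Circ}
    (hT : ∀ v, D.mark v ≠ 0 → v ∈ T) : D.degree = ∑ v ∈ T, (D.mark v : ℤ) := by
  refine Finset.sum_subset (fun v hv => hT v (by simpa using hv)) fun v _ hv => ?_
  have : D.mark v = 0 := by simpa using hv
  simp [this]

open Classical in
theorem label_eq_sum (D : CircleKnotDiagram S) {T : Finset Circ}
    (hT : ∀ v, D.mark v ≠ 0 → v ∈ T) (p t : Circ) :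
    D.label p t = ∑ v ∈ T, if sbtw p v t then (D.mark v : ℤ) else 0 := by
  rw [label, Finset.sum_filter]
  refine Finset.sum_subset (fun v hv => hT v (by simpa using hv)) fun v _ hv => ?_
  have : D.mark v = 0 := by simpa using hv
  simp [this]

theorem label_self (D : CircleKnotDiagram S) (p : Circ) : D.label p p = 0 := by
  simp [label, sbtw_irrefl_left_right]

theorem label_of_sbtw (D : CircleKnotDiagram S) {p s t : Circ} (h : sbtw p s t) :
    D.label p t = D.label p s + (D.mark s : ℤ) + D.label s t := by
  classical
  have hT : ∀ v, D.mark v ≠ 0 → v ∈ insert s D.finite_mark.toFinset := by simp +contextual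
  have hs : (D.mark s : ℤ) =
      ∑ v ∈ insert s D.finite_mark.toFinset, if v = s then (D.mark v : ℤ) else 0 := by simp
  rw [D.label_eq_sum hT, D.label_eq_sum hT, D.label_eq_sum hT, hs, ← Finset.sum_add_distrib,
    ← Finset.sum_add_distrib]
  refine Finset.sum_congr rfl fun v _ => ?_
  have h1 := sbtw_iff_of_sbtw h v
  have h2 : sbtw p v s → ¬ sbtw s v t := not_sbtw_of_sbtw_of_sbtw h
  have h3 : sbtw p v s → v ≠ s := by rintro h rfl; exact sbtw_irrefl_right h
  have h4 : sbtw s v t → v ≠ s := by rintro h rfl; exact sbtw_irrefl_left h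
  by_cases a1 : sbtw p v s <;> by_cases a2 : v = s <;> by_cases a3 : sbtw s v t <;> simp_all

/-- Once around the circle, all the vertices are met. -/
theorem label_add_label (D : CircleKnotDiagram S) {s t : Circ} (h : s ≠ t) :
    D.label s t + D.label t s + (D.mark s : ℤ) + (D.mark t : ℤ) = D.degree := by
  classical
  set T := insert s (insert t D.finite_mark.toFinset)
  have hT : ∀ v, D.mark v ≠ 0 → v ∈ T := by simp +contextual [T]
  have hs : (D.mark s : ℤ) = ∑ v ∈ T, if v = s then (D.mark v : ℤ) else 0 := by simp [T]
  have ht : (D.mark t : ℤ) = ∑ v ∈ T, if v = t then (D.mark v : ℤ) else 0 := by simp [T]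
  rw [D.label_eq_sum hT, D.label_eq_sum hT, D.degree_eq_sum hT, hs, ht, ← Finset.sum_add_distrib,
    ← Finset.sum_add_distrib, ← Finset.sum_add_distrib]
  refine Finset.sum_congr rfl fun v _ => ?_
  by_cases a1 : v = s
  · subst a1
    simp [sbtw_irrefl_left, sbtw_irrefl_right, h]
  by_cases a2 : v = t
  · subst a2
    simp [sbtw_irrefl_left, sbtw_irrefl_right, a1]
  rcases sbtw_or_sbtw_of_ne (Ne.symm a1) a2 h.symm with h' | h' <;>
    simp [h', h'.not_sbtw, a1, a2]

/-- In degree `0`, moving the fixed point changes all labels by the same amount. -/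
theorem label_eq_label_add_label (D : CircleKnotDiagram S) (hD : D.degree = 0) {p s : Circ}
    (hp : D.mark p = 0) (hs : D.mark s = 0) (t : Circ) :
    D.label p t = D.label p s + D.label s t := by
  rcases eq_or_ne p s with rfl | hps
  · simp [label_self]
  have hsum := D.label_add_label hps
  simp only [hD, hp, hs, SignType.coe_zero] at hsum
  rcases eq_or_ne s t with rfl | hst
  · simp [label_self]
  rcases eq_or_ne t p with rfl | htp
  · rw [label_self]; omega
  rcases sbtw_or_sbtw_of_ne hps hst htp with h | h
  · simpa [hs] using D.label_of_sbtw h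
  · have := D.label_of_sbtw h.cyclic_left
    simp only [hp, SignType.coe_zero] at this
    omega

/-- In degree `0`, the label is constant on an arc without vertices. -/
theorem label_eq_of_mem_cIcc (D : CircleKnotDiagram S) (hD : D.degree = 0) {p a b t : Circ}
    (hp : D.mark p = 0) (hab : a ≠ b) (h : ∀ v ∈ cIcc a b, D.mark v = 0) (ht : t ∈ cIcc a b) :
    D.label p t = D.label p a := by
  rw [D.label_eq_label_add_label hD hp (h a (left_mem_cIcc a b)), add_eq_left, label]
  classical
  refine Finset.sum_eq_zero fun v hv => ?_
  have hv : sbtw a v t := (Finset.mem_filter.1 hv).2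
  rw [h v, SignType.coe_zero]
  rcases eq_or_ne t b with rfl | htb
  · exact hv.btw
  have hta : a ≠ t := by rintro rfl; exact sbtw_irrefl_left_right hv
  rcases sbtw_or_sbtw_of_ne hta htb hab.symm with h' | h'
  · exact (hv.trans_right h').btw
  · exact absurd ht h'.not_btw

/-- The fixed point has no influence on the lifted diagram of a diagram of degree `0`. -/
theorem lift_eq_lift (D : CircleKnotDiagram S) (hD : D.degree = 0) {p q : Circ}
    (hp : D.mark p = 0) (hq : D.mark q = 0) : D.lift p = D.lift q := by
  have h : ∀ s t, (D.lift p).isOver s t ↔ (D.lift q).isOver s t := fun s t => by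
    simp only [lift, D.label_eq_label_add_label hD hp hq s, D.label_eq_label_add_label hD hp hq t,
      add_lt_add_iff_left, add_right_inj]
  have : (D.lift p).isOver = (D.lift q).isOver := by
    ext s t
    exact h s t
  unfold lift at this ⊢
  simp only [KnotDiagram.mk.injEq, true_and]
  exact this

theorem lift_classical_iff (D : CircleKnotDiagram S) (p s t : Circ) :
    (D.lift p).Classical s t ↔ D.Classical s t := by
  simp only [KnotDiagram.Classical, lift]
  rcases lt_trichotomy (D.label p s) (D.label p t) with h | h | h <;> grind

theorem lift_noVirtual_iff (D : CircleKnotDiagram S) (p : Circ) :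
    (D.lift p).NoVirtual ↔ D.NoVirtual :=
  forall₂_congr fun s t => imp_congr Iff.rfl (D.lift_classical_iff p s t)

end CircleKnotDiagram

/-! ### Knot diagrams -/

namespace KnotDiagram

variable {S : Type*} [TopologicalSpace S]

theorem eq_of_isOver_iff {D D' : KnotDiagram S} (hc : ∀ t, D.curve t = D'.curve t)
    (ho : ∀ s t, D.isOver s t ↔ D'.isOver s t) : D = D' := by
  have h1 : D.curve = D'.curve := funext hc
  have h2 : D.isOver = D'.isOver := by
    ext s t
    exact ho s t
  cases D
  cases D'
  simpa only [mk.injEq] using ⟨h1, h2⟩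

theorem move_refl (D : KnotDiagram S) : Move D D :=
  .inl ⟨fun _ => .refl S, .refl Circ, ⟨⟨continuous_snd, rfl⟩, fun _ _ _ h => h, fun _ => rfl,
    fun _ _ => Iff.rfl⟩⟩

end KnotDiagram

namespace CircleKnotDiagram

variable {S : Type*} [TopologicalSpace S] {D D' : CircleKnotDiagram S}

/-! ### Equal marks, reparametrisation and isotopy -/

theorem degree_congr (h : ∀ t, D.mark t = D'.mark t) : D.degree = D'.degree := by
  rw [D.degree_eq_sum (T := D.finite_mark.toFinset) (by simp),
    D'.degree_eq_sum (T := D.finite_mark.toFinset) (by simp [h])]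
  simp [h]

theorem label_congr (h : ∀ t, D.mark t = D'.mark t) (p t : Circ) :
    D.label p t = D'.label p t := by
  classical
  rw [D.label_eq_sum (T := D.finite_mark.toFinset) (by simp),
    D'.label_eq_sum (T := D.finite_mark.toFinset) (by simp [h])]
  simp [h]

theorem degree_reparam {ρ : Circ ≃ₜ Circ} (h : ∀ t, D'.mark t = D.mark (ρ t)) :
    D'.degree = D.degree := by
  have hT : ∀ v, D.mark v ≠ 0 → v ∈ D'.finite_mark.toFinset.map ρ.toEquiv.toEmbedding :=
    fun v hv => Finset.mem_map.2 ⟨ρ.symm v, by simpa [h] using hv, by simp⟩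
  rw [D.degree_eq_sum hT, Finset.sum_map, D'.degree_eq_sum (T := D'.finite_mark.toFinset) (by simp)]
  simp [h]

theorem label_reparam {ρ : Circ ≃ₜ Circ} (hρ : KnotDiagram.OrientationPreserving ρ)
    (h : ∀ t, D'.mark t = D.mark (ρ t)) (p t : Circ) :
    D'.label p t = D.label (ρ p) (ρ t) := by
  classical
  have hT : ∀ v, D.mark v ≠ 0 → v ∈ D'.finite_mark.toFinset.map ρ.toEquiv.toEmbedding :=
    fun v hv => Finset.mem_map.2 ⟨ρ.symm v, by simpa [h] using hv, by simp⟩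
  rw [D.label_eq_sum hT, Finset.sum_map,
    D'.label_eq_sum (T := D'.finite_mark.toFinset) (by simp)]
  simp [h, hρ.sbtw_iff]

theorem isotopicVia_lift {F : unitInterval → S ≃ₜ S} {ρ : Circ ≃ₜ Circ}
    (h : D.toKnotDiagram.IsotopicVia D'.toKnotDiagram F ρ) (hm : ∀ t, D'.mark t = D.mark (ρ t))
    (p : Circ) : (D.lift (ρ p)).IsotopicVia (D'.lift p) F ρ where
  isotopy := h.isotopy
  orientation := h.orientation
  curve_eq := h.curve_eq
  over_iff s t := by
    simp only [lift, KnotDiagram.Classical, h.over_iff, label_reparam h.orientation hm]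

/-! ### Moves in a disc without vertices -/

theorem sameOutside_lift {f : UnitDisc → S} {n : ℕ} {a b : Fin n → Circ}
    (h : KnotDiagram.SameOutside D.toKnotDiagram D'.toKnotDiagram f a b)
    (hm : SameMarksOff D D' a b) (p : Circ) :
    KnotDiagram.SameOutside (D.lift p) (D'.lift p) f a b where
  left := { h.left with }
  right := { h.right with }
  curve_eq := h.curve_eq
  over_iff s t hs ht := by
    simp only [lift, KnotDiagram.Classical, h.over_iff s t hs ht, h.over_iff t s ht hs,
      label_congr hm.1]

theorem r1_lift {f : UnitDisc → S} {a b : Fin 1 → Circ}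
    (h : KnotDiagram.R1 D.toKnotDiagram D'.toKnotDiagram f a b)
    (hm : SameMarksOff D D' a b) (p : Circ) :
    KnotDiagram.R1 (D.lift p) (D'.lift p) f a b where
  same := sameOutside_lift h.same hm p
  kink := h.kink
  straight := h.straight

theorem r2_lift {f : UnitDisc → S} {a b : Fin 2 → Circ}
    (h : KnotDiagram.R2 D.toKnotDiagram D'.toKnotDiagram f a b)
    (hm : SameMarksOff D D' a b) (hD : D.degree = 0) {p : Circ} (hp : D.mark p = 0) :
    KnotDiagram.R2 (D.lift p) (D'.lift p) f a b where
  same := sameOutside_lift h.same hm p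
  bigon := by
    obtain ⟨s₁, hs₁, s₂, hs₂, t₁, ht₁, t₂, ht₂, hs, h₁, h₂, hall, ho, ho'⟩ := h.bigon
    refine ⟨s₁, hs₁, s₂, hs₂, t₁, ht₁, t₂, ht₂, hs, h₁, h₂, hall, ?_⟩
    have hl : ∀ i, ∀ t ∈ cIcc (a i) (b i), D.label p t = D.label p (a i) := fun i _ ht =>
      D.label_eq_of_mem_cIcc hD hp (h.same.left.ne i) (hm.2 i) ht
    simp only [lift, KnotDiagram.Classical, hl 0 _ hs₁, hl 0 _ hs₂, hl 1 _ ht₁, hl 1 _ ht₂, ho, ho',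
      iff_self, and_self]
  straight := h.straight

/-- `hl` says that the lift places every arc on a single horizontal plane. -/
theorem arcOver_lift_iff {n : ℕ} {a b : Fin n → Circ} {p : Circ}
    (hl : ∀ i, ∀ t ∈ cIcc (a i) (b i), D.label p t = D.label p (a i)) (i j : Fin n) :
    (D.lift p).ArcOver a b i j ↔ (D.ArcOver a b i j ∨ D.ArcOver a b j i) ∧
      D.label p (a j) < D.label p (a i) ∨
      D.label p (a i) = D.label p (a j) ∧ D.ArcOver a b i j := by
  constructor
  · rintro ⟨s, hs, t, ht, hc, h⟩
    rw [hl i s hs, hl j t ht] at h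
    refine h.imp (fun h => ⟨hc.imp ?_ ?_, h⟩) fun h => ⟨h.1, s, hs, t, ht, h.2⟩
    exacts [fun h => ⟨s, hs, t, ht, h⟩, fun h => ⟨t, ht, s, hs, h⟩]
  · rintro (⟨⟨s, hs, t, ht, h⟩ | ⟨t, ht, s, hs, h⟩, h'⟩ | ⟨h', s, hs, t, ht, h⟩)
    · exact ⟨s, hs, t, ht, .inl h, .inl (by rwa [hl i s hs, hl j t ht])⟩
    · exact ⟨s, hs, t, ht, .inr h, .inl (by rwa [hl i s hs, hl j t ht])⟩
    · exact ⟨s, hs, t, ht, .inl h, .inr ⟨by rwa [hl i s hs, hl j t ht], h⟩⟩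

/-- Heights `h`, refined by levels `l` that take precedence, can be encoded in one integer. -/
theorem exists_lex_height {n : ℕ} (l h : Fin n → ℤ) (hh : Function.Injective h) :
    ∃ k : Fin n → ℤ, Function.Injective k ∧
      ∀ i j, k j < k i → l j < l i ∨ l i = l j ∧ h j < h i := by
  -- `2 * B + 1` exceeds every difference of heights, so it is a suitable distance of levels
  set B := ∑ i, |h i|
  have hB : ∀ i, |h i| ≤ B := fun i =>
    Finset.single_le_sum (f := fun i => |h i|) (fun _ _ => abs_nonneg _) (Finset.mem_univ i)
  have key : ∀ i j, l i < l j → (2 * B + 1) * l i + h i < (2 * B + 1) * l j + h j := by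
    intro i j hij
    have hi := abs_le.1 (hB i)
    have hj := abs_le.1 (hB j)
    nlinarith
  refine ⟨fun i => (2 * B + 1) * l i + h i, fun i j hij => hh ?_, fun i j hij => ?_⟩
  · rcases lt_trichotomy (l i) (l j) with h' | h' | h'
    · exact absurd hij (key i j h').ne
    · simpa [h'] using hij
    · exact absurd hij (key j i h').ne'
  · rcases lt_trichotomy (l i) (l j) with h' | h' | h'
    · exact absurd hij (key i j h').not_gt
    · exact .inr ⟨h', by simpa [h'] using hij⟩
    · exact .inl h'

theorem r3_lift {f : UnitDisc → S} {a b : Fin 3 → Circ}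
    (h : KnotDiagram.R3 D.toKnotDiagram D'.toKnotDiagram f a b)
    (hm : SameMarksOff D D' a b) (hD : D.degree = 0) {p : Circ} (hp : D.mark p = 0) :
    KnotDiagram.R3 (D.lift p) (D'.lift p) f a b := by
  have hl : ∀ i, ∀ t ∈ cIcc (a i) (b i), D.label p t = D.label p (a i) := fun i _ ht =>
    D.label_eq_of_mem_cIcc hD hp (h.same.left.ne i) (hm.2 i) ht
  have hl' : ∀ i, ∀ t ∈ cIcc (a i) (b i), D'.label p t = D'.label p (a i) := fun i t ht => by
    rw [← label_congr hm.1, ← label_congr hm.1, hl i t ht]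
  refine ⟨sameOutside_lift h.same hm p, h.left, h.right, fun i j => ?_, ?_⟩
  · simp only [arcOver_lift_iff hl, arcOver_lift_iff hl', h.over_iff, label_congr hm.1]
  · simp only [arcOver_lift_iff hl]
    refine h.type.imp ?_ ?_
    · rintro ⟨k, hk, ho⟩
      obtain ⟨k', hk', ho'⟩ := exists_lex_height (fun i => D.label p (a i)) k hk
      refine ⟨k', hk', fun i j hij => ?_⟩
      rcases ho' i j hij with h' | ⟨h', hkk⟩
      · have hne : k j ≠ k i := hk.ne (by rintro rfl; exact hij.false)
        exact .inl ⟨hne.lt_or_gt.imp (ho i j) (ho j i), h'⟩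
      · exact .inr ⟨h', ho i j hkk⟩
    · rintro ⟨k, hk⟩
      exact ⟨k, fun j => by simp [hk j]⟩

/-! ### Moves of vertices -/

/-- The marks of `D` are those of `D'` with an additional vertex of sign `m` at `v` and one of sign
`-m` at `v'`. A vertex sliding from `v` to `v'` and the creation of two opposite vertices both have
this form. -/
def AddsDipole (D D' : CircleKnotDiagram S) (v v' : Circ) (m : ℤ) : Prop :=
  open Classical in ∀ t, (D.mark t : ℤ) =
    (D'.mark t : ℤ) + (if t = v then m else 0) - (if t = v' then m else 0)

open Classical in
theorem AddsDipole.degree_eq {v v' : Circ} {m : ℤ} (h : AddsDipole D D' v v' m) :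
    D.degree = D'.degree := by
  set T := insert v (insert v' (D.finite_mark.toFinset ∪ D'.finite_mark.toFinset))
  rw [D.degree_eq_sum (T := T) (by simp +contextual [T]),
    D'.degree_eq_sum (T := T) (by simp +contextual [T]), Finset.sum_congr rfl fun t _ => h t]
  simp [Finset.sum_add_distrib, Finset.sum_sub_distrib, T]

open Classical in
theorem AddsDipole.label_eq {v v' : Circ} {m : ℤ} (h : AddsDipole D D' v v' m) (p t : Circ) :
    D.label p t =
      D'.label p t + (if sbtw p v t then m else 0) - (if sbtw p v' t then m else 0) := by
  set T := insert v (insert v' (D.finite_mark.toFinset ∪ D'.finite_mark.toFinset))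
  have hv : (if sbtw p v t then m else 0) =
      ∑ r ∈ T, if r = v then (if sbtw p r t then m else 0) else 0 := by simp [T]
  have hv' : (if sbtw p v' t then m else 0) =
      ∑ r ∈ T, if r = v' then (if sbtw p r t then m else 0) else 0 := by simp [T]
  rw [D.label_eq_sum (T := T) (by simp +contextual [T]),
    D'.label_eq_sum (T := T) (by simp +contextual [T]), hv, hv', ← Finset.sum_add_distrib,
    ← Finset.sum_sub_distrib]
  refine Finset.sum_congr rfl fun r _ => ?_
  rw [h r]
  split_ifs <;> simp

/-- A dipole is invisible outside the arc between its two vertices. -/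
theorem AddsDipole.label_eq_of_notMem {v v' : Circ} {m : ℤ} (h : AddsDipole D D' v v' m)
    {p t : Circ} (hp : p ∉ cIcc v v') (ht : t ∉ cIcc v v') : D.label p t = D'.label p t := by
  rw [h.label_eq, sbtw_left_iff_right (sbtw_iff_not_btw.2 hp) (sbtw_iff_not_btw.2 ht)]
  ring

theorem SlideVia.addsDipole {v v' s u : Circ} (h : SlideVia D D' v v' s u) :
    AddsDipole D D' v v' (D.mark v : ℤ) := by
  have hne : v ≠ v' := by rintro rfl; exact sbtw_irrefl_left_right h.between
  intro t
  by_cases ht : t ∈ cIcc v v'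
  · rcases eq_or_ne t v with rfl | htv
    · simp [h.mark_right t ht hne, hne]
    rcases eq_or_ne t v' with rfl | htv'
    · simp [h.mark_left t ht htv, h.mark_eq, htv]
    · simp [h.mark_left t ht htv, h.mark_right t ht htv', htv, htv']
  · have htv : t ≠ v := by rintro rfl; exact ht (left_mem_cIcc _ _)
    have htv' : t ≠ v' := by rintro rfl; exact ht (right_mem_cIcc _ _)
    simp [h.mark_off t ht, htv, htv']

theorem CancelVia.addsDipole {v v' : Circ} (h : CancelVia D D' v v') :
    AddsDipole D D' v v' (D.mark v : ℤ) := by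
  intro t
  by_cases ht : t ∈ cIcc v v'
  · rcases eq_or_ne t v with rfl | htv
    · simp [h.mark_right t ht, h.ne]
    rcases eq_or_ne t v' with rfl | htv'
    · simp [h.mark_right t ht, h.mark_neg, htv]
    · simp [h.mark_left t ht htv htv', h.mark_right t ht, htv, htv']
  · have htv : t ≠ v := by rintro rfl; exact ht (left_mem_cIcc _ _)
    have htv' : t ≠ v' := by rintro rfl; exact ht (right_mem_cIcc _ _)
    simp [h.mark_off t ht, htv, htv']

/-- All labels at crossings are the same before and after two opposite vertices are cancelled. -/
theorem CancelVia.lift_eq {v v' : Circ} (h : CancelVia D D' v v') (hD : D.degree = 0)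
    {p p' : Circ} (hp : D.mark p = 0) (hp' : D'.mark p' = 0) : D.lift p = D'.lift p' := by
  have hD' : D'.degree = 0 := h.addsDipole.degree_eq ▸ hD
  have hc : ∀ s t, D.Classical s t ↔ D'.Classical s t := fun s t =>
    or_congr (h.over_iff s t) (h.over_iff t s)
  have hoff : ∀ s t, D.Crossing s t → s ∉ cIcc v v' := fun s t hst hs =>
    h.no_double s hs ⟨t, hst.1.symm, hst.2.symm⟩
  refine KnotDiagram.eq_of_isOver_iff h.curve_eq fun s t => ?_
  by_cases hst : D.Classical s t
  swap
  · exact iff_of_false (fun h' => hst h'.1) fun h' => hst ((hc s t).2 h'.1)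
  have hx := D.crossing_of_classical hst
  have hx' := D'.crossing_of_classical ((hc s t).1 hst)
  -- the crossing itself is an admissible fixed point, off the arc between the two vertices
  rw [D.lift_eq_lift hD hp (D.mark_eq_zero_of_crossing hx),
    D'.lift_eq_lift hD' hp' (D'.mark_eq_zero_of_crossing hx')]
  simp only [lift, hc, h.over_iff, label_self,
    h.addsDipole.label_eq_of_notMem (hoff s t hx) (hoff t s ⟨hx.1.symm, hx.2.symm⟩)]

theorem SlideVia.classical_iff {v v' s u : Circ} (h : SlideVia D D' v v' s u) (r t : Circ) :
    D.Classical r t ↔ D'.Classical r t := by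
  have hsu : D.Classical s u ↔ D'.Classical s u := by
    rcases h.type with ⟨h1, h2⟩ | ⟨-, h1, h2⟩ | ⟨-, h1, h2⟩
    exacts [iff_of_false h1 h2, iff_of_true (.inr h1) (.inl h2), iff_of_true (.inl h1) (.inr h2)]
  by_cases h1 : r = s ∧ t = u
  · rwa [h1.1, h1.2]
  by_cases h2 : r = u ∧ t = s
  · rw [h2.1, h2.2]
    exact or_comm.trans (hsu.trans or_comm)
  exact or_congr (h.over_iff r t h1 h2) (h.over_iff t r (fun h => h2 h.symm) fun h => h1 h.symm)

/-- At the crossing passed by a vertex, the change of the label makes up for the switch of the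
over/under information. -/
theorem SlideVia.lift_eq {v v' s u : Circ} (h : SlideVia D D' v v' s u) (hD : D.degree = 0)
    {p p' : Circ} (hp : D.mark p = 0) (hp' : D'.mark p' = 0) : D.lift p = D'.lift p' := by
  have hD' : D'.degree = 0 := h.addsDipole.degree_eq ▸ hD
  have hcross : ∀ r t, D.Crossing r t → D'.Crossing r t := fun r t hrt =>
    ⟨hrt.1, by rw [← h.curve_eq, ← h.curve_eq, hrt.2]⟩
  have hxu : D.Crossing u s := ⟨h.crossing.1.symm, h.crossing.2.symm⟩
  have hoff : ∀ r t, D.Crossing r t → r ≠ s → r ∉ cIcc v v' := fun r t hrt hr hmem =>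
    h.only r hmem hr ⟨t, hrt.1.symm, hrt.2.symm⟩
  have hu := hoff u s hxu hxu.1
  -- the parameter `u` on the other arc lies off the arc along which the vertex slides, so labels
  -- are counted from there
  rw [D.lift_eq_lift hD hp (D.mark_eq_zero_of_crossing hxu),
    D'.lift_eq_lift hD' hp' (D'.mark_eq_zero_of_crossing (hcross u s hxu))]
  have hlab : ∀ r t, D.Crossing r t → r ≠ s → D.label u r = D'.label u r := fun r t hrt hr =>
    h.addsDipole.label_eq_of_notMem hu (hoff r t hrt hr)
  have hlabs : D.label u s = D'.label u s + (D.mark v : ℤ) := by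
    have h1 : sbtw u v v' := (sbtw_iff_not_btw.2 hu : sbtw v' u v).cyclic_left
    have h2 : sbtw v v' u := h1.cyclic_left
    have h3 : sbtw u v s := (h.between.trans_right h2).cyclic_right
    have h4 : ¬ sbtw u v' s := fun h' =>
      ((sbtw_iff_of_sbtw h1 s).2 (.inr (.inr h.between))).not_sbtw h'.cyclic_left
    rw [h.addsDipole.label_eq, if_pos h3, if_neg h4, sub_zero]
  refine KnotDiagram.eq_of_isOver_iff h.curve_eq fun r t => ?_
  by_cases hrt : D.Classical r t
  swap
  · exact iff_of_false (fun h' => hrt h'.1) fun h' => hrt ((h.classical_iff r t).2 h'.1)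
  have hx := D.crossing_of_classical hrt
  simp only [lift, ← h.classical_iff, hrt, true_and]
  by_cases h1 : r = s ∧ t = u
  · obtain ⟨rfl, rfl⟩ := h1
    rw [label_self, label_self, hlabs]
    rcases h.type with ⟨h1, -⟩ | ⟨hv, h1, h2⟩ | ⟨hv, h1, h2⟩
    · exact absurd hrt h1
    · simp only [hv, h2, D.over_asymm _ _ h1, SignType.coe_one, and_true, and_false, or_false]
      omega
    · simp only [hv, h1, D'.over_asymm _ _ h2, SignType.coe_neg_one, and_true, and_false, or_false]
      omega
  by_cases h2 : r = u ∧ t = s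
  · obtain ⟨rfl, rfl⟩ := h2
    rw [label_self, label_self, hlabs]
    rcases h.type with ⟨h1, -⟩ | ⟨hv, h1, h2⟩ | ⟨hv, h1, h2⟩
    · exact absurd hrt.symm h1
    · simp only [hv, h1, D'.over_asymm _ _ h2, SignType.coe_one, and_true, and_false, or_false]
      omega
    · simp only [hv, h2, D.over_asymm _ _ h1, SignType.coe_neg_one, and_true, and_false, or_false]
      omega
  -- there are no triple points, so `s` and `u` are no parameters of any other crossing
  have hr : r ≠ s := by
    rintro rfl
    have := D.no_triple t r u hx.2.symm h.crossing.2
    exact this.elim (fun e => hx.1 e.symm) fun e => e.elim h.crossing.1 fun e => h1 ⟨rfl, e⟩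
  have ht : t ≠ s := by
    rintro rfl
    have := D.no_triple r t u hx.2 h.crossing.2
    exact this.elim hx.1 fun e => e.elim h.crossing.1 fun e => h2 ⟨e, rfl⟩
  rw [hlab r t hx hr, hlab t r ⟨hx.1.symm, hx.2.symm⟩ ht, h.over_iff r t h1 h2]

/-! ### Equivalence -/

theorem Move.degree_eq (h : Move D D') : D.degree = D'.degree := by
  rcases h with ⟨F, ρ, -, hm⟩ | ⟨f, a, b, -, hm⟩ | ⟨f, a, b, -, hm⟩ | ⟨f, a, b, -, hm⟩ |
    ⟨v, v', s, u, h⟩ | ⟨v, v', h⟩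
  exacts [(degree_reparam hm).symm, degree_congr hm.1, degree_congr hm.1, degree_congr hm.1,
    h.addsDipole.degree_eq, h.addsDipole.degree_eq]

/-- A move in `S × S¹` lifts to a move of the same kind, and to the identity if it is a move of
vertices. -/
theorem Move.lift (h : Move D D') (hD : D.degree = 0) {p p' : Circ} (hp : D.mark p = 0)
    (hp' : D'.mark p' = 0) : KnotDiagram.Move (D.lift p) (D'.lift p') := by
  have hD' : D'.degree = 0 := h.degree_eq ▸ hD
  have hdisc : (∀ t, D.mark t = D'.mark t) → D'.lift p' = D'.lift p := fun hm =>
    D'.lift_eq_lift hD' hp' (hm p ▸ hp)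
  rcases h with ⟨F, ρ, h, hm⟩ | ⟨f, a, b, h, hm⟩ | ⟨f, a, b, h, hm⟩ | ⟨f, a, b, h, hm⟩ |
    ⟨v, v', s, u, h⟩ | ⟨v, v', h⟩
  · rw [D.lift_eq_lift hD hp (q := ρ p') (hm p' ▸ hp')]
    exact .inl ⟨F, ρ, isotopicVia_lift h hm p'⟩
  · rw [hdisc hm.1]
    exact .inr (.inl ⟨f, a, b, r1_lift h hm p⟩)
  · rw [hdisc hm.1]
    exact .inr (.inr (.inl ⟨f, a, b, r2_lift h hm hD hp⟩))
  · rw [hdisc hm.1]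
    exact .inr (.inr (.inr ⟨f, a, b, r3_lift h hm hD hp⟩))
  · rw [h.lift_eq hD hp hp']
    exact KnotDiagram.move_refl _
  · rw [h.lift_eq hD hp hp']
    exact KnotDiagram.move_refl _

/-- Lifting turns chains of moves into chains of moves, as soon as it does so for single ones. -/
theorem lift_eqvGen {r : CircleKnotDiagram S → CircleKnotDiagram S → Prop}
    {r' : KnotDiagram S → KnotDiagram S → Prop} (hr : ∀ D D', r D D' → Move D D')
    (hr' : ∀ D D' p p', r D D' → KnotDiagram.Move (D.lift p) (D'.lift p') →
      r' (D.lift p) (D'.lift p')) (h : Relation.EqvGen r D D') :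
    D.degree = D'.degree ∧ (D.degree = 0 → ∀ p p', D.mark p = 0 → D'.mark p' = 0 →
      Relation.EqvGen r' (D.lift p) (D'.lift p')) := by
  induction h with
  | rel D D' h =>
    exact ⟨(hr _ _ h).degree_eq, fun hD p p' hp hp' =>
      .rel _ _ (hr' _ _ _ _ h ((hr _ _ h).lift hD hp hp'))⟩
  | refl D => exact ⟨rfl, fun hD p p' hp hp' => D.lift_eq_lift hD hp hp' ▸ .refl _⟩
  | symm D D' _ ih =>
    exact ⟨ih.1.symm, fun hD p p' hp hp' => .symm _ _ (ih.2 (ih.1.trans hD) p' p hp' hp)⟩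
  | trans D D' D'' _ _ ih ih' =>
    refine ⟨ih.1.trans ih'.1, fun hD p p' hp hp' => ?_⟩
    obtain ⟨q, hq⟩ := D'.exists_mark_eq_zero
    exact .trans _ _ _ (ih.2 hD p q hp hq) (ih'.2 (ih.1.symm.trans hD) q p' hq hp')

end CircleKnotDiagram

theorem mainTheorem2 :
    -- diagrams on the plane, with virtual crossings
    (∀ (D D' : CircleKnotDiagram Plane) (p p' : Circ), D.degree = 0 →
      D.mark p = 0 → D'.mark p' = 0 → D.Equivalent D' →
        D'.degree = 0 ∧ (D.lift p).Equivalent (D'.lift p')) ∧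
    -- diagrams on a surface, without virtual crossings
    (∀ (S : Type*) [TopologicalSpace S] [T2Space S] [ChartedSpace Plane S]
      (D D' : CircleKnotDiagram S) (p p' : Circ), D.degree = 0 →
      D.mark p = 0 → D'.mark p' = 0 → D.ClassicallyEquivalent D' →
        D'.degree = 0 ∧ (D.lift p).ClassicallyEquivalent (D'.lift p')) := by
  refine ⟨fun D D' p p' hD hp hp' h => ?_, fun S _ _ _ D D' p p' hD hp hp' h => ?_⟩
  · have key := CircleKnotDiagram.lift_eqvGen (r' := KnotDiagram.Move) (fun _ _ h => h)
      (fun _ _ _ _ _ h => h) h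
    exact ⟨key.1 ▸ hD, key.2 hD p p' hp hp'⟩
  · have key := CircleKnotDiagram.lift_eqvGen
      (r' := fun D D' : KnotDiagram S => D.Move D' ∧ D.NoVirtual ∧ D'.NoVirtual)
      (fun _ _ h => h.1) (fun D D' p p' h h' => ⟨h', (D.lift_noVirtual_iff p).2 h.2.1,
        (D'.lift_noVirtual_iff p').2 h.2.2⟩) h
    exact ⟨key.1 ▸ hD, key.2 hD p p' hp hp'⟩
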